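/- Let $(\Omega,\mathcal F,P)$ be a probability space and $\mathcal A\subseteq\mathcal B\subseteq\mathcal F$ $\sigma$-algebras, where $\mathcal B$ is the smallest $\sigma$-algebra containing all $P$-null events and some countable family of events. Write $L_\infty(\mathcal B)=L_\infty(\Omega,\mathcal B,P)$ (real-valued, classes modulo $P$-a.s. equality, ordered $P$-a.s.), $L_\infty^+(\mathcal B)$ for its cone of non-negative elements, and similarly for $\mathcal A$. Let $L$ be a linear subspace of $L_\infty(\mathcal B)$. Let $M:L_\infty^+(\mathcal B)\to L_\infty^+(\mathcal A)$ be sublinear, i.e. $M(X+Y)\le M(X)+M(Y)$ and $M(\lambda X)=\lambda M(X)$ for all $X,Y\in L_\infty^+(\mathcal B)$ and real $\lambda\ge 0$, and regular, i.e. $M(X_n)\to0$ $P$-a.s. for every non-increasing sequence $(X_n)$ in $L_\infty^+(\mathcal B)$ with $X_n\downarrow0$ $P$-a.s. Let $m:L_\infty^+(\mathcal B)\to L_\infty^+(\mathcal A)$ be superlinear, i.e. $m(X+Y)\ge m(X)+m(Y)$ and $m(\lambda X)=\lambda m(X)$ for all $X,Y\in L_\infty^+(\mathcal B)$ and real $\lambda\ge0$.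 Let $x:L\to L_\infty(\mathcal A)$ be a linear operator satisfying the sandwich condition $$m(Z)+x(X)\le M(Y)\qquad\text{for all }X\in L,\ Y,Z\in L_\infty^+(\mathcal B)\text{ with }Z+X\le Y.$$ Then $x$ extends to a monotone linear operator $\hat x:L_\infty(\mathcal B)\to L_\infty(\mathcal A)$ that is continuous from above (i.e. $\hat x(X_n)\downarrow \hat x(X)$ $P$-a.s. for every non-increasing sequence $(X_n)$ in $L_\infty(\mathcal B)$ converging $P$-a.s. to some $X\in L_\infty(\mathcal B)$) and satisfies the sandwich condition $$m(Z)+\hat x(X)\le M(Y)\qquad\text{for all }X\in L_\infty(\mathcal B),\ Y,Z\in L_\infty^+(\mathcal B)\text{ with }Z+X\le Y,$$ as well as $m(X)\le \hat x(X)\le M(X)$ for all $X\in L_\infty^+(\mathcal B)$. Moreover, for any linear operator $y:L_\infty(\mathcal B)\to L_\infty(\mathcal A)$ the last two conditions (with $y$ in place of $\hat x$) are equivalent. -/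

import Mathlib

open MeasureTheory Filter Topology
open scoped ENNReal

/-- The real Banach lattice `L∞(μ)` of a.e.-classes of essentially bounded measurable functions,
with the a.e. order. -/
abbrev Linfty {Ω : Type*} {m : MeasurableSpace Ω} (μ : Measure Ω) : Type _ :=
  Lp ℝ ∞ μ

/-- Multiplication by a nonnegative real is monotone for the a.e. order. -/
instance instPosSMulMonoLinfty {Ω : Type*} {m : MeasurableSpace Ω} (μ : Measure Ω) :
    PosSMulMono ℝ (Linfty μ) where
  smul_le_smul_of_nonneg_left := by
    intro c hc X Y hXY
    rw [← Lp.coeFn_le] at hXY ⊢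
    filter_upwards [hXY, Lp.coeFn_smul c X, Lp.coeFn_smul c Y] with ω h hX hY
    rw [hX, hY]
    exact mul_le_mul_of_nonneg_left h hc

/-- The cone `L∞⁺(μ)` of the elements `X` of `L∞(μ)` with `0 ≤ X`. -/
abbrev LinftyPos {Ω : Type*} {m : MeasurableSpace Ω} (μ : Measure Ω) : Type _ :=
  {X : Linfty μ // 0 ≤ X}

namespace LinftyPos

variable {Ω : Type*} {m : MeasurableSpace Ω} {μ : Measure Ω}

/-- The sum of two elements of the cone. -/
def sum (X Y : LinftyPos μ) : LinftyPos μ :=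
  ⟨(X : Linfty μ) + (Y : Linfty μ), add_nonneg X.2 Y.2⟩

/-- A nonnegative real multiple of an element of the cone. -/
def scale (c : ℝ) (hc : 0 ≤ c) (X : LinftyPos μ) : LinftyPos μ :=
  ⟨c • (X : Linfty μ), smul_nonneg hc X.2⟩

end LinftyPos

/-- `B` is the smallest sigma-algebra that contains some countable family of events
together with all `P`-null events. -/
def CountablyGeneratedModNull {Ω : Type*} {F : MeasurableSpace Ω} (P : Measure Ω)
    (B : MeasurableSpace Ω) : Prop :=
  ∃ S : ℕ → Set Ω, B = MeasurableSpace.generateFrom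
    (Set.range S ∪ {N : Set Ω | MeasurableSet[F] N ∧ P N = 0})

/-- `X n ↓ X` almost surely: the sequence is non-increasing and converges a.s. to `X`. -/
def DecreasesTo {Ω : Type*} {m : MeasurableSpace Ω} {μ : Measure Ω}
    (X : ℕ → Linfty μ) (X' : Linfty μ) : Prop :=
  Antitone X ∧ ∀ᵐ ω ∂μ, Tendsto (fun n => X n ω) atTop (𝓝 (X' ω))

section Operators

variable {Ω : Type*} {mB mA : MeasurableSpace Ω} {μ : @Measure Ω mB} {ν : @Measure Ω mA}

/-- Sublinear operator `L∞⁺ → L∞⁺`. -/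
structure IsSublinearOp (M : LinftyPos μ → LinftyPos ν) : Prop where
  add_le : ∀ X Y : LinftyPos μ,
    (M (LinftyPos.sum X Y) : Linfty ν) ≤ (M X : Linfty ν) + (M Y : Linfty ν)
  smul_eq : ∀ (c : ℝ) (hc : 0 ≤ c) (X : LinftyPos μ),
    (M (LinftyPos.scale c hc X) : Linfty ν) = c • (M X : Linfty ν)

/-- Superlinear operator `L∞⁺ → L∞⁺`. -/
structure IsSuperlinearOp (m : LinftyPos μ → LinftyPos ν) : Prop where
  le_add : ∀ X Y : LinftyPos μ,
    (m X : Linfty ν) + (m Y : Linfty ν) ≤ (m (LinftyPos.sum X Y) : Linfty ν)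
  smul_eq : ∀ (c : ℝ) (hc : 0 ≤ c) (X : LinftyPos μ),
    (m (LinftyPos.scale c hc X) : Linfty ν) = c • (m X : Linfty ν)

/-- Regularity: `M (X n) → 0` a.s. whenever `X n ↓ 0` a.s. -/
def IsRegularOp (M : LinftyPos μ → LinftyPos ν) : Prop :=
  ∀ X : ℕ → LinftyPos μ, DecreasesTo (fun n => (X n : Linfty μ)) 0 →
    ∀ᵐ ω ∂ν, Tendsto (fun n => (M (X n) : Linfty ν) ω) atTop (𝓝 0)

/-- Continuity from above (at every point): `X n ↓ X` a.s. implies `x (X n) ↓ x X` a.s. -/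
def IsContinuousFromAbove (x : Linfty μ → Linfty ν) : Prop :=
  ∀ (X : ℕ → Linfty μ) (X' : Linfty μ), DecreasesTo X X' →
    DecreasesTo (fun n => x (X n)) (x X')

/-- The sandwich condition for an operator `x` on a linear subspace `L` of `L∞`:
`m Z + x X ≤ M Y` whenever `X ∈ L`, `Y, Z ∈ L∞⁺` and `Z + X ≤ Y`. -/
def SandwichCondition (m M : LinftyPos μ → LinftyPos ν) (L : Submodule ℝ (Linfty μ))
    (x : L → Linfty ν) : Prop :=
  ∀ (X : L) (Y Z : LinftyPos μ), (Z : Linfty μ) + (X : Linfty μ) ≤ (Y : Linfty μ) →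
    (m Z : Linfty ν) + x X ≤ (M Y : Linfty ν)

/-- The pointwise form `m X ≤ x X ≤ M X` for all `X ∈ L∞⁺`. -/
def LiesBetween (m M : LinftyPos μ → LinftyPos ν) (x : Linfty μ → Linfty ν) : Prop :=
  ∀ X : LinftyPos μ, (m X : Linfty ν) ≤ x X ∧ x X ≤ (M X : Linfty ν)

end Operators

/-!
The operator `x'` is produced by a Hahn–Banach–Kantorovich argument. The sandwich condition for an
operator `y` says that `y X ≤ g` for every pair `(X, g)` in the set

  `{(X, g) | ∃ Y Z ≥ 0, Z + X ≤ Y ∧ M Y - m Z ≤ g}`,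

which is a convex cone (`sandwichCone`) because `M` is sublinear and `m` is superlinear. Since every
`X` satisfies `X⁻ + X ≤ X⁺`, every `X` occurs as a first coordinate. Under this condition a
partially defined linear operator dominated by the cone extends to the whole space
(`LinearPMap.exists_linearMap_le_of_convexCone`): by Zorn's lemma it is enough to extend to one more
vector, and the values admissible for that vector are those separating two nonempty sets of `L∞`
one of which lies below the other. A separating element exists because `L∞` of a `σ`-finite measure
is Dedekind complete (`exists_between_of_forall_le_Linfty`). The latter is deduced from the complete
lattice of measures: up to translation, the elements of the lower set are densities, the supremum of
the corresponding measures is absolutely continuous, and its density separates the two sets.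

The remaining properties are formal. Choosing `Y` or `Z` to be zero in the sandwich condition gives
`m ≤ x' ≤ M` on the cone of nonnegative elements. This bound implies that `x'` is monotone because
`0 ≤ m`, and that it is continuous from above because
`0 ≤ x' (X n) - x' X = x' (X n - X) ≤ M (X n - X)` and `M` is regular.
-/

/-! ### Extension of operators dominated by a convex cone -/

section Extension

variable {E G : Type*} [AddCommGroup E] [Module ℝ E] [AddCommGroup G] [PartialOrder G]
  [IsOrderedAddMonoid G] [Module ℝ G] [PosSMulMono ℝ G]

/-- One-step extension: a partial operator dominated by a cone `C` extends to a strictly larger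
domain. The hypothesis `hG` is Dedekind completeness of `G`, in the form of cuts. -/
theorem LinearPMap.exists_lt_le_of_convexCone
    (hG : ∀ S T : Set G, S.Nonempty → T.Nonempty → (∀ s ∈ S, ∀ t ∈ T, s ≤ t) →
      ∃ c, (∀ s ∈ S, s ≤ c) ∧ ∀ t ∈ T, c ≤ t)
    (C : ConvexCone ℝ (E × G)) (hC : ∀ v, ∃ g, (v, g) ∈ C) (f : E →ₗ.[ℝ] G)
    (hf : ∀ (X : f.domain) (g : G), ((X : E), g) ∈ C → f X ≤ g) (hdom : f.domain ≠ ⊤) :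
    ∃ h, f < h ∧ ∀ (X : h.domain) (g : G), ((X : E), g) ∈ C → h X ≤ g := by
  obtain ⟨v, -, hv⟩ : ∃ v ∈ (⊤ : Submodule ℝ E), v ∉ f.domain :=
    SetLike.exists_of_lt (lt_top_iff_ne_top.2 hdom)
  obtain ⟨c, hlow, hupp⟩ := hG
    {s | ∃ (X : f.domain) (g : G), ((X : E) - v, g) ∈ C ∧ s = f X - g}
    {t | ∃ (X : f.domain) (g : G), ((X : E) + v, g) ∈ C ∧ t = g - f X}
    (by
      obtain ⟨g, hg⟩ := hC (-v)
      exact ⟨_, 0, g, by simpa using hg, rfl⟩)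
    (by
      obtain ⟨g, hg⟩ := hC v
      exact ⟨_, 0, g, by simpa using hg, rfl⟩)
    (by
      rintro _ ⟨X₁, g₁, h₁, rfl⟩ _ ⟨X₂, g₂, h₂, rfl⟩
      have h := hf (X₁ + X₂) (g₁ + g₂) (by
        convert C.add_mem h₁ h₂ using 1
        ext
        · simp
        · simp)
      rw [f.map_add] at h
      rw [sub_le_iff_le_add, sub_add_eq_add_sub, le_sub_iff_add_le, add_comm g₂]
      exact h)
  refine ⟨f.supSpanSingleton v c hv, ?_, ?_⟩
  · refine lt_iff_le_not_ge.2 ⟨f.left_le_sup _ _, fun H => ?_⟩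
    replace H := LinearPMap.domain_mono.monotone H
    rw [LinearPMap.domain_supSpanSingleton, sup_le_iff, Submodule.span_le,
      Set.singleton_subset_iff] at H
    exact hv H.2
  · rintro ⟨z, hz⟩ g hzg
    rcases Submodule.mem_sup.1 hz with ⟨X, hX, w, hw, rfl⟩
    rcases Submodule.mem_span_singleton.1 hw with ⟨r, rfl⟩
    simp only at hzg
    rw [LinearPMap.supSpanSingleton_apply_mk _ _ _ _ _ hX, RingHom.id_apply]
    rcases lt_trichotomy r 0 with hr | rfl | hr
    · have hr' : 0 < (-r)⁻¹ := inv_pos.2 (neg_pos.2 hr)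
      have hmem : (((-r)⁻¹ • (⟨X, hX⟩ : f.domain) : f.domain) - v, (-r)⁻¹ • g) ∈ C := by
        convert C.smul_mem hr' hzg using 1
        ext
        · simp [smul_smul, inv_mul_cancel₀ hr.ne, sub_eq_add_neg, add_comm]
        · simp
      have h := hlow _ ⟨_, _, hmem, rfl⟩
      rw [f.map_smul, ← smul_sub] at h
      have h' := smul_le_smul_of_nonneg_left h (neg_pos.2 hr).le
      rw [smul_smul, mul_inv_cancel₀ (neg_pos.2 hr).ne', one_smul, neg_smul, sub_le_iff_le_add]
        at h'
      rw [neg_add_eq_sub, le_sub_iff_add_le] at h'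
      exact h'
    · rw [zero_smul, add_zero] at hzg ⊢
      exact hf ⟨X, hX⟩ g hzg
    · have hmem : ((r⁻¹ • (⟨X, hX⟩ : f.domain) : f.domain) + v, r⁻¹ • g) ∈ C := by
        convert C.smul_mem (inv_pos.2 hr) hzg using 1
        ext
        · simp [smul_smul, inv_mul_cancel₀ hr.ne']
        · simp
      have h := hupp _ ⟨_, _, hmem, rfl⟩
      rw [f.map_smul, ← smul_sub] at h
      have h' := smul_le_smul_of_nonneg_left h hr.le
      rw [smul_smul, mul_inv_cancel₀ hr.ne', one_smul, le_sub_iff_add_le, add_comm] at h'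
      exact h'

/-- **Hahn–Banach–Kantorovich theorem**, with the sublinear dominating operator replaced by a convex
cone `C` of pairs `(X, g)`, each of which expresses the bound `F X ≤ g`. -/
theorem LinearPMap.exists_linearMap_le_of_convexCone
    (hG : ∀ S T : Set G, S.Nonempty → T.Nonempty → (∀ s ∈ S, ∀ t ∈ T, s ≤ t) →
      ∃ c, (∀ s ∈ S, s ≤ c) ∧ ∀ t ∈ T, c ≤ t)
    (C : ConvexCone ℝ (E × G)) (hC : ∀ v, ∃ g, (v, g) ∈ C) (f : E →ₗ.[ℝ] G)
    (hf : ∀ (X : f.domain) (g : G), ((X : E), g) ∈ C → f X ≤ g) :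
    ∃ F : E →ₗ[ℝ] G, (∀ X : f.domain, F X = f X) ∧ ∀ X g, (X, g) ∈ C → F X ≤ g := by
  set S := {p : E →ₗ.[ℝ] G | ∀ (X : p.domain) (g : G), ((X : E), g) ∈ C → p X ≤ g}
  have hchain : ∀ c, c ⊆ S → IsChain (· ≤ ·) c → ∀ y ∈ c, ∃ ub ∈ S, ∀ z ∈ c, z ≤ ub := by
    intro c hcS hc y hy
    have hcd : DirectedOn (· ≤ ·) c := hc.directedOn
    refine ⟨LinearPMap.sSup c hcd, ?_, fun _ => LinearPMap.le_sSup hcd⟩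
    rintro ⟨X, hX⟩ g hXg
    obtain ⟨p, hpc, hpX⟩ := (LinearPMap.mem_domain_sSup_iff ⟨y, hy⟩ hcd).1 hX
    have hp : p ≤ LinearPMap.sSup c hcd := LinearPMap.le_sSup hcd hpc
    exact (hp.2 (x := ⟨X, hpX⟩) (y := ⟨X, hX⟩) rfl).symm.trans_le (hcS hpc ⟨X, hpX⟩ g hXg)
  obtain ⟨q, hfq, hqS, hq⟩ := zorn_le_nonempty₀ S hchain f hf
  have htop : q.domain = ⊤ := by
    by_contra hne
    obtain ⟨h, hlt, hh⟩ := LinearPMap.exists_lt_le_of_convexCone hG C hC q hqS hne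
    exact hlt.not_ge (hq hh hlt.le)
  obtain ⟨d, q⟩ := q
  obtain rfl : d = ⊤ := htop
  exact ⟨q ∘ₗ (Submodule.topEquiv (R := ℝ) (M := E)).symm.toLinearMap,
    fun X => (hfq.2 (x := X) (y := ⟨X, Submodule.mem_top⟩) rfl).symm,
    fun X g hXg => hqS ⟨X, Submodule.mem_top⟩ g hXg⟩

end Extension

/-! ### Dedekind completeness of `L∞` -/

/-- `L∞` of a `σ`-finite measure is Dedekind complete, in the form of cuts: if every element of a
nonempty set `S` lies below every element of a nonempty set `T`, some element separates `S` and
`T`. -/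
theorem exists_between_of_forall_le_Linfty {Ω : Type*} {mΩ : MeasurableSpace Ω} {ν : Measure Ω}
    [SigmaFinite ν] (S T : Set (Linfty ν)) (hS : S.Nonempty) (hT : T.Nonempty)
    (h : ∀ s ∈ S, ∀ t ∈ T, s ≤ t) :
    ∃ c, (∀ s ∈ S, s ≤ c) ∧ ∀ t ∈ T, c ≤ t := by
  obtain ⟨s₀, hs₀⟩ := hS
  obtain ⟨t₀, ht₀⟩ := hT
  -- `ENNReal.ofReal` clips at zero, so `φ u` is the positive part of `u - s₀`.
  let φ : Linfty ν → Ω → ℝ≥0∞ := fun u ω => ENNReal.ofReal (u ω - s₀ ω)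
  have hφ : ∀ u, Measurable (φ u) := fun u =>
    ((Lp.stronglyMeasurable u).measurable.sub (Lp.stronglyMeasurable s₀).measurable).ennreal_ofReal
  let κ : Measure Ω := sSup ((fun s => ν.withDensity (φ s)) '' S)
  have hκT : ∀ t ∈ T, κ ≤ ν.withDensity (φ t) := by
    intro t ht
    refine sSup_le ?_
    rintro _ ⟨s, hs, rfl⟩
    refine withDensity_mono ?_
    filter_upwards [(Lp.coeFn_le s t).2 (h s hs t ht)] with ω hω
    exact ENNReal.ofReal_le_ofReal (sub_le_sub_right hω _)
  have : SigmaFinite (ν.withDensity (φ t₀)) :=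
    SigmaFinite.withDensity_of_ne_top (ae_of_all _ fun ω => ENNReal.ofReal_ne_top)
  have hκac : κ ≪ ν :=
    (Measure.absolutelyContinuous_of_le (hκT t₀ ht₀)).trans (withDensity_absolutelyContinuous _ _)
  have : SigmaFinite κ := Measure.sigmaFinite_of_le _ (hκT t₀ ht₀)
  have hκ : ν.withDensity (κ.rnDeriv ν) = κ := Measure.withDensity_rnDeriv_eq κ ν hκac
  set f := κ.rnDeriv ν
  have hf : Measurable f := Measure.measurable_rnDeriv κ ν
  have hle : ∀ a b : Ω → ℝ≥0∞, Measurable a → ν.withDensity a ≤ ν.withDensity b → a ≤ᵐ[ν] b := by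
    intro a b ha hab
    refine ae_le_of_forall_setLIntegral_le_of_sigmaFinite ha fun s hs _ => ?_
    simpa [withDensity_apply _ hs] using hab s
  have hSf : ∀ s ∈ S, φ s ≤ᵐ[ν] f := fun s hs =>
    hle _ _ (hφ s) (hκ ▸ le_sSup ⟨s, hs, rfl⟩)
  have hfT : ∀ t ∈ T, f ≤ᵐ[ν] φ t := fun t ht => hle _ _ hf (hκ ▸ hκT t ht)
  have hs₀T : ∀ t ∈ T, ∀ᵐ ω ∂ν, s₀ ω ≤ t ω := fun t ht => (Lp.coeFn_le _ _).2 (h s₀ hs₀ t ht)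
  have hbound : ∀ t ∈ T, ∀ᵐ ω ∂ν, (f ω).toReal ≤ t ω - s₀ ω := by
    intro t ht
    filter_upwards [hfT t ht, hs₀T t ht] with ω hω hst
    exact ENNReal.toReal_le_of_le_ofReal (sub_nonneg.2 hst) hω
  have hmem : MemLp (fun ω => (f ω).toReal) ∞ ν := by
    refine ((Lp.memLp t₀).sub (Lp.memLp s₀)).mono hf.ennreal_toReal.aestronglyMeasurable ?_
    filter_upwards [hbound t₀ ht₀] with ω hω
    rw [Real.norm_of_nonneg ENNReal.toReal_nonneg]
    exact hω.trans (le_abs_self _)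
  refine ⟨hmem.toLp + s₀, fun s hs => ?_, fun t ht => ?_⟩
  · rw [← Lp.coeFn_le]
    filter_upwards [hSf s hs, hfT t₀ ht₀, hmem.coeFn_toLp, Lp.coeFn_add hmem.toLp s₀]
      with ω h₁ h₂ h₃ h₄
    rw [h₄, Pi.add_apply, h₃, ← sub_le_iff_le_add]
    exact (ENNReal.ofReal_le_iff_le_toReal (ne_top_of_le_ne_top ENNReal.ofReal_ne_top h₂)).1 h₁
  · rw [← Lp.coeFn_le]
    filter_upwards [hbound t ht, hmem.coeFn_toLp, Lp.coeFn_add hmem.toLp s₀] with ω h₁ h₂ h₃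
    rw [h₃, Pi.add_apply, h₂, ← le_sub_iff_add_le]
    exact h₁

/-! ### The sandwich condition -/

section Sandwich

variable {Ω : Type*} {mB mA : MeasurableSpace Ω} {μ : @Measure Ω mB} {ν : @Measure Ω mA}
  {m M : LinftyPos μ → LinftyPos ν}

theorem IsSublinearOp.map_zero (hM : IsSublinearOp M) :
    (M ⟨0, le_rfl⟩ : Linfty ν) = 0 := by
  have h := hM.smul_eq 0 le_rfl ⟨0, le_rfl⟩
  simpa [LinftyPos.scale] using h

theorem IsSuperlinearOp.map_zero (hm : IsSuperlinearOp m) :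
    (m ⟨0, le_rfl⟩ : Linfty ν) = 0 := by
  have h := hm.smul_eq 0 le_rfl ⟨0, le_rfl⟩
  simpa [LinftyPos.scale] using h

/-- The convex cone of the pairs `(X, g)` for which the sandwich condition demands `x X ≤ g`. -/
def sandwichCone (hM : IsSublinearOp M) (hm : IsSuperlinearOp m) :
    ConvexCone ℝ (Linfty μ × Linfty ν) where
  carrier := {p | ∃ Y Z : LinftyPos μ, (Z : Linfty μ) + p.1 ≤ Y ∧
    (M Y : Linfty ν) - (m Z : Linfty ν) ≤ p.2}
  smul_mem' := by
    rintro c hc p ⟨Y, Z, h₁, h₂⟩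
    refine ⟨Y.scale c hc.le, Z.scale c hc.le, ?_, ?_⟩
    · have h := smul_le_smul_of_nonneg_left h₁ hc.le
      rw [smul_add] at h
      exact h
    · rw [hM.smul_eq, hm.smul_eq, ← smul_sub]
      exact smul_le_smul_of_nonneg_left h₂ hc.le
  add_mem' := by
    rintro p ⟨Y, Z, h₁, h₂⟩ p' ⟨Y', Z', h₁', h₂'⟩
    refine ⟨Y.sum Y', Z.sum Z', ?_, ?_⟩
    · have h := add_le_add h₁ h₁'
      rw [add_add_add_comm] at h
      exact h
    · refine (sub_le_sub (hM.add_le Y Y') (hm.le_add Z Z')).trans ?_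
      rw [add_sub_add_comm]
      exact add_le_add h₂ h₂'

theorem mem_sandwichCone {hM : IsSublinearOp M} {hm : IsSuperlinearOp m} {X : Linfty μ}
    {g : Linfty ν} : (X, g) ∈ sandwichCone hM hm ↔
      ∃ Y Z : LinftyPos μ, (Z : Linfty μ) + X ≤ Y ∧ (M Y : Linfty ν) - (m Z : Linfty ν) ≤ g :=
  Iff.rfl

theorem exists_mem_sandwichCone (hM : IsSublinearOp M) (hm : IsSuperlinearOp m) (X : Linfty μ) :
    ∃ g, (X, g) ∈ sandwichCone hM hm := by
  refine ⟨_, mem_sandwichCone.2 ⟨⟨X ⊔ 0, le_sup_right⟩, ⟨X ⊔ 0 - X, ?_⟩, ?_, le_rfl⟩⟩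
  · exact sub_nonneg.2 le_sup_left
  · simp

/-- An operator satisfying the sandwich condition on a subspace extends to the whole space. -/
theorem SandwichCondition.exists_extension [SigmaFinite ν] (hM : IsSublinearOp M)
    (hm : IsSuperlinearOp m) {L : Submodule ℝ (Linfty μ)} {x : L →ₗ[ℝ] Linfty ν}
    (hx : SandwichCondition m M L x) :
    ∃ x' : Linfty μ →ₗ[ℝ] Linfty ν, (∀ X : L, x' X = x X) ∧
      SandwichCondition m M ⊤ (fun X => x' X) := by
  obtain ⟨x', hext, hle⟩ := LinearPMap.exists_linearMap_le_of_convexCone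
    exists_between_of_forall_le_Linfty (sandwichCone hM hm) (exists_mem_sandwichCone hM hm) ⟨L, x⟩
    (fun X g ⟨Y, Z, h₁, h₂⟩ => (le_sub_iff_add_le'.2 (hx X Y Z h₁)).trans h₂)
  exact ⟨x', hext, fun X Y Z h =>
    le_sub_iff_add_le'.1 (hle X _ (mem_sandwichCone.2 ⟨Y, Z, h, le_rfl⟩))⟩

theorem LiesBetween.monotone {y : Linfty μ →ₗ[ℝ] Linfty ν} (hy : LiesBetween m M y) :
    Monotone y := by
  intro X Y hXY
  have h := (m ⟨Y - X, sub_nonneg.2 hXY⟩).2.trans (hy ⟨Y - X, sub_nonneg.2 hXY⟩).1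
  rwa [map_sub, sub_nonneg] at h

theorem sandwichCondition_top_iff_liesBetween (hM : IsSublinearOp M) (hm : IsSuperlinearOp m)
    (y : Linfty μ →ₗ[ℝ] Linfty ν) :
    SandwichCondition m M ⊤ (fun X => y X) ↔ LiesBetween m M y := by
  refine ⟨fun h X => ⟨?_, ?_⟩, fun h X Y Z hle => ?_⟩
  · have hX : (m X : Linfty ν) + y (-X) ≤ (M ⟨0, le_rfl⟩ : Linfty ν) :=
      h ⟨-X, Submodule.mem_top⟩ ⟨0, le_rfl⟩ X (by simp)
    rw [hM.map_zero, map_neg, ← sub_eq_add_neg, sub_nonpos] at hX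
    exact hX
  · have hX : (m ⟨0, le_rfl⟩ : Linfty ν) + y X ≤ M X :=
      h ⟨X, Submodule.mem_top⟩ X ⟨0, le_rfl⟩ (by simp)
    rwa [hm.map_zero, zero_add] at hX
  · calc (m Z : Linfty ν) + y X ≤ y Z + y X := by gcongr; exact (h Z).1
      _ = y (Z + X) := (map_add y _ _).symm
      _ ≤ y Y := h.monotone hle
      _ ≤ M Y := (h Y).2

/-- A linear operator between `m` and a regular operator `M` is continuous from above. -/
theorem LiesBetween.isContinuousFromAbove (hMreg : IsRegularOp M)
    {y : Linfty μ →ₗ[ℝ] Linfty ν} (hy : LiesBetween m M y) : IsContinuousFromAbove y := by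
  rintro X X' ⟨hanti, hlim⟩
  refine ⟨fun i j hij => hy.monotone (hanti hij), ?_⟩
  have hge : ∀ n, X' ≤ X n := by
    intro n
    rw [← Lp.coeFn_le]
    have hmono : ∀ᵐ ω ∂μ, ∀ k, X (n + k) ω ≤ X n ω :=
      ae_all_iff.2 fun k => (Lp.coeFn_le _ _).2 (hanti (Nat.le_add_right n k))
    filter_upwards [hlim, hmono] with ω hω hmω
    refine le_of_tendsto hω ?_
    filter_upwards [eventually_ge_atTop n] with k hk
    simpa [Nat.add_sub_cancel' hk] using hmω (k - n)
  have hreg := hMreg (fun n => ⟨X n - X', sub_nonneg.2 (hge n)⟩)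
    ⟨fun i j hij => sub_le_sub_right (hanti hij) X', by
      filter_upwards [hlim, ae_all_iff.2 fun n => Lp.coeFn_sub (X n) X', Lp.coeFn_zero ℝ ∞ μ]
        with ω hω hsub hzero
      simp only [hsub, hzero, Pi.sub_apply, Pi.zero_apply]
      simpa using hω.sub_const (X' ω)⟩
  have hupper : ∀ᵐ ω ∂ν, ∀ n, y (X n - X') ω ≤
      (M ⟨X n - X', sub_nonneg.2 (hge n)⟩ : Linfty ν) ω :=
    ae_all_iff.2 fun n => (Lp.coeFn_le _ _).2 (hy ⟨X n - X', sub_nonneg.2 (hge n)⟩).2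
  have hlower : ∀ᵐ ω ∂ν, ∀ n, y X' ω ≤ y (X n) ω :=
    ae_all_iff.2 fun n => (Lp.coeFn_le _ _).2 (hy.monotone (hge n))
  have hsub : ∀ᵐ ω ∂ν, ∀ n, y (X n - X') ω = y (X n) ω - y X' ω := by
    refine ae_all_iff.2 fun n => ?_
    rw [map_sub]
    exact Lp.coeFn_sub _ _
  filter_upwards [hreg, hupper, hlower, hsub] with ω h₁ h₂ h₃ h₄
  rw [← tendsto_sub_nhds_zero_iff]
  exact squeeze_zero (fun n => sub_nonneg.2 (h₃ n)) (fun n => (h₄ n).symm.trans_le (h₂ n)) h₁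

end Sandwich

theorem mainTheorem2 {Ω : Type*} {F : MeasurableSpace Ω} (P : Measure Ω) [IsProbabilityMeasure P]
    (A B : MeasurableSpace Ω) (hAB : A ≤ B) (hBF : B ≤ F)
    (hB : CountablyGeneratedModNull P B)
    (L : Submodule ℝ (Linfty (P.trim hBF)))
    (M m : LinftyPos (P.trim hBF) → LinftyPos (P.trim (hAB.trans hBF)))
    (hM : IsSublinearOp M) (hMreg : IsRegularOp M) (hm : IsSuperlinearOp m)
    (x : L →ₗ[ℝ] Linfty (P.trim (hAB.trans hBF)))
    (hx : SandwichCondition m M L x) :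
    (∃ x' : Linfty (P.trim hBF) →ₗ[ℝ] Linfty (P.trim (hAB.trans hBF)),
      (∀ X : L, x' X = x X) ∧ Monotone x' ∧ IsContinuousFromAbove x' ∧
      SandwichCondition m M ⊤ (fun X => x' X) ∧ LiesBetween m M x') ∧
    (∀ y : Linfty (P.trim hBF) →ₗ[ℝ] Linfty (P.trim (hAB.trans hBF)),
      SandwichCondition m M ⊤ (fun X => y X) ↔ LiesBetween m M y) := by
  have hiff := sandwichCondition_top_iff_liesBetween hM hm
  obtain ⟨x', hext, hsand⟩ := hx.exists_extension hM hm
  have hbetween := (hiff x').1 hsand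
  exact ⟨⟨x', hext, hbetween.monotone, hbetween.isContinuousFromAbove hMreg, hsand, hbetween⟩, hiff⟩
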